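/- Let $X$ be a smooth affine algebraic variety over $\mathbb C$. A *geometric classical r-matrix* on $X$ is a derivation $r$ of the algebra $\mathbb C[X\times X]$ (a vector field on $X\times X$) such that $$[r_{12},r_{13}]+[r_{12},r_{23}]+[r_{13},r_{23}]=0 \text{ on } \mathbb C[X\times X\times X],\qquad r+r_{21}=0 \text{ on } \mathbb C[X\times X].$$ A *formal diffeomorphism* of an affine variety $Y$ is a $\mathbb C$-algebra homomorphism $g:\mathbb C[Y]\to\mathbb C[Y][[\hbar]]$ with $g=1+O(\hbar)$; formal diffeomorphisms are multiplied by composition after extending them $\mathbb C[[\hbar]]$-linearly and $\hbar$-adically continuously to $\mathbb C[Y][[\hbar]]$. A *geometric quantum R-matrix* on $X$ is a formal diffeomorphism $R$ of $X\times X$ such that $$R_{12}R_{13}R_{23}=R_{23}R_{13}R_{12},\qquad RR_{21}=1.$$ Here $r_{ij}$ and $R_{ij}$ denote $r$ and $R$ acting in the $i$-th and $j$-th factors, in this order. **Theorem 1.** Every geometric classical r-matrix $r$ on $X$ admits a quantization, that is, there is a geometric quantum R-matrix $R$ on $X$ with $R=1+\hbar r+O(\hbar^2)$. -/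

import Mathlib

open scoped TensorProduct PowerSeries

noncomputable section

namespace GeometricRMatrix

/-! `X` is represented by its coordinate ring `A = ℂ[X]`, so that `ℂ[X × X] = A ⊗[ℂ] A` and
`ℂ[X × X × X] = (A ⊗[ℂ] A) ⊗[ℂ] A`. The variable of the power series is `ħ`. -/

section Legs

variable (A : Type*) [CommRing A] [Algebra ℂ A]

/-- The exchange of the two factors, `a ⊗ b ↦ b ⊗ a`. -/
def flip : A ⊗[ℂ] A ≃ₐ[ℂ] A ⊗[ℂ] A := Algebra.TensorProduct.comm ℂ A A

/-- The cyclic permutation `(a ⊗ b) ⊗ c ↦ (b ⊗ c) ⊗ a`. -/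
def cyc : (A ⊗[ℂ] A) ⊗[ℂ] A ≃ₐ[ℂ] (A ⊗[ℂ] A) ⊗[ℂ] A :=
  (Algebra.TensorProduct.assoc ℂ ℂ ℂ A A A).trans (Algebra.TensorProduct.comm ℂ A (A ⊗[ℂ] A))

/-- The transposition `(a ⊗ b) ⊗ c ↦ (a ⊗ c) ⊗ b`. -/
def swap23 : (A ⊗[ℂ] A) ⊗[ℂ] A ≃ₐ[ℂ] (A ⊗[ℂ] A) ⊗[ℂ] A :=
  (Algebra.TensorProduct.assoc ℂ ℂ ℂ A A A).trans <|
    (Algebra.TensorProduct.congr AlgEquiv.refl (Algebra.TensorProduct.comm ℂ A A)).trans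
      (Algebra.TensorProduct.assoc ℂ ℂ ℂ A A A).symm

@[simp] lemma flip_tmul (a b : A) : flip A (a ⊗ₜ b) = b ⊗ₜ a := rfl

@[simp] lemma cyc_tmul (a b c : A) : cyc A ((a ⊗ₜ b) ⊗ₜ c) = (b ⊗ₜ c) ⊗ₜ a := rfl

@[simp] lemma swap23_tmul (a b c : A) : swap23 A ((a ⊗ₜ b) ⊗ₜ c) = (a ⊗ₜ c) ⊗ₜ b := rfl

end Legs

section Classical

variable {A : Type*} [CommRing A] [Algebra ℂ A]

/-- The conjugate `e⁻¹ ∘ D ∘ e` of an operator by an automorphism. -/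
def conjEnd {B : Type*} [CommRing B] [Algebra ℂ B] (e : B ≃ₐ[ℂ] B) (D : Module.End ℂ B) :
    Module.End ℂ B :=
  e.symm.toLinearMap ∘ₗ D ∘ₗ e.toLinearMap

/-- The operator `r₂₁` on `ℂ[X × X]`. -/
def op21 (r : Module.End ℂ (A ⊗[ℂ] A)) : Module.End ℂ (A ⊗[ℂ] A) := conjEnd (flip A) r

/-- The operator `r₁₂ = r ⊗ 1` on `ℂ[X × X × X]`. -/
def op12 (r : Module.End ℂ (A ⊗[ℂ] A)) : Module.End ℂ ((A ⊗[ℂ] A) ⊗[ℂ] A) :=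
  LinearMap.rTensor A r

/-- The operator `r₁₃` on `ℂ[X × X × X]`. -/
def op13 (r : Module.End ℂ (A ⊗[ℂ] A)) : Module.End ℂ ((A ⊗[ℂ] A) ⊗[ℂ] A) :=
  conjEnd (swap23 A) (op12 r)

/-- The operator `r₂₃` on `ℂ[X × X × X]`. -/
def op23 (r : Module.End ℂ (A ⊗[ℂ] A)) : Module.End ℂ ((A ⊗[ℂ] A) ⊗[ℂ] A) :=
  conjEnd (cyc A) (op12 r)

/-- A geometric classical r-matrix: a vector field on `X × X` satisfying the classical Yang–Baxter
equation and unitarity. The brackets are commutators of operators, that is, brackets of vector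
fields on `X × X × X`. -/
structure IsClassicalRMatrix (r : Derivation ℂ (A ⊗[ℂ] A) (A ⊗[ℂ] A)) : Prop where
  cybe : ⁅op12 r.toLinearMap, op13 r.toLinearMap⁆ + ⁅op12 r.toLinearMap, op23 r.toLinearMap⁆
    + ⁅op13 r.toLinearMap, op23 r.toLinearMap⁆ = 0
  unitarity : r.toLinearMap + op21 r.toLinearMap = 0

end Classical

section Formal

variable {B : Type*} [CommRing B] [Algebra ℂ B]

/-- `g` is a formal diffeomorphism of the variety with coordinate ring `B`: `g = 1 + O(ħ)`. -/
def IsFormalDiffeo (g : B →ₐ[ℂ] B⟦X⟧) : Prop :=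
  ∀ F : B, PowerSeries.coeff 0 (g F) = F

/-- The coefficients of `∑ g(F_j) ħ^j`. -/
def hExtFun (g : B →ₐ[ℂ] B⟦X⟧) (F : B⟦X⟧) : B⟦X⟧ :=
  PowerSeries.mk fun n => ∑ p ∈ Finset.HasAntidiagonal.antidiagonal n,
    PowerSeries.coeff p.1 (g (PowerSeries.coeff p.2 F))

lemma hExtFun_C (g : B →ₐ[ℂ] B⟦X⟧) (b : B) : hExtFun g (PowerSeries.C b) = g b := by
  ext n
  simp only [hExtFun, PowerSeries.coeff_mk]
  rw [Finset.sum_eq_single (n, 0)]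
  · simp
  · rintro ⟨i, j⟩ hij hne
    have hj : j ≠ 0 := by
      rintro rfl
      simp at hij
      simp [hij] at hne
    simp [PowerSeries.coeff_C, hj]
  · simp

lemma hExtFun_mul (g : B →ₐ[ℂ] B⟦X⟧) (F G : B⟦X⟧) :
    hExtFun g (F * G) = hExtFun g F * hExtFun g G := by
  ext n
  simp only [hExtFun, PowerSeries.coeff_mk, PowerSeries.coeff_mul, map_sum, map_mul,
    Finset.sum_mul_sum]
  simp only [Finset.sum_sigma']
  refine Finset.sum_nbij'
    (fun x => ⟨(x.2.2.1 + x.2.1.1, x.2.2.2 + x.2.1.2),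
      ⟨(x.2.2.1, x.2.1.1), (x.2.2.2, x.2.1.2)⟩⟩)
    (fun y => ⟨(y.2.1.1 + y.2.2.1, y.2.1.2 + y.2.2.2),
      ⟨(y.2.1.2, y.2.2.2), (y.2.1.1, y.2.2.1)⟩⟩)
    ?_ ?_ ?_ ?_ ?_
  · rintro ⟨⟨i, j⟩, ⟨k, l⟩, ⟨p, q⟩⟩ h
    simp only [Finset.mem_sigma, Finset.HasAntidiagonal.mem_antidiagonal, and_true] at h ⊢
    obtain ⟨h1, h2, h3⟩ := h
    omega
  · rintro ⟨⟨i, j⟩, ⟨k, l⟩, ⟨p, q⟩⟩ h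
    simp only [Finset.mem_sigma, Finset.HasAntidiagonal.mem_antidiagonal, and_true] at h ⊢
    obtain ⟨h1, h2, h3⟩ := h
    omega
  · rintro ⟨⟨i, j⟩, ⟨k, l⟩, ⟨p, q⟩⟩ h
    simp only [Finset.mem_sigma, Finset.HasAntidiagonal.mem_antidiagonal] at h
    obtain ⟨-, rfl, rfl⟩ := h
    rfl
  · rintro ⟨⟨i, j⟩, ⟨k, l⟩, ⟨p, q⟩⟩ h
    simp only [Finset.mem_sigma, Finset.HasAntidiagonal.mem_antidiagonal] at h
    obtain ⟨-, rfl, rfl⟩ := h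
    rfl
  · intro x _
    rfl

/-- The `ħ`-adically continuous `ℂ[[ħ]]`-linear extension `∑ F_j ħ^j ↦ ∑ g(F_j) ħ^j` of `g` to
power series. -/
def hExt (g : B →ₐ[ℂ] B⟦X⟧) : B⟦X⟧ →ₐ[ℂ] B⟦X⟧ where
  toFun := hExtFun g
  map_one' := by
    rw [← map_one (PowerSeries.C (R := B)), hExtFun_C]; simp
  map_mul' := hExtFun_mul g
  map_zero' := by ext n; simp [hExtFun]
  map_add' F G := by ext n; simp [hExtFun, Finset.sum_add_distrib]
  commutes' c := by
    have h : algebraMap ℂ B⟦X⟧ c = PowerSeries.C (algebraMap ℂ B c) := PowerSeries.algebraMap_apply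
    rw [h, hExtFun_C, AlgHom.commutes, h]

/-- The product `g h`: first `h`, then `g` extended to power series. -/
def mulFormal (g h : B →ₐ[ℂ] B⟦X⟧) : B →ₐ[ℂ] B⟦X⟧ := (hExt g).comp h

/-- The inclusion `B → B[[ħ]]`, the identity among formal diffeomorphisms. -/
def oneFormal : B →ₐ[ℂ] B⟦X⟧ := IsScalarTower.toAlgHom ℂ B B⟦X⟧

/-- The conjugate `e⁻¹ ∘ g ∘ e`, with `e⁻¹` applied to coefficients. -/
def conjFormal (e : B ≃ₐ[ℂ] B) (g : B →ₐ[ℂ] B⟦X⟧) : B →ₐ[ℂ] B⟦X⟧ :=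
  (PowerSeries.mapAlgHom e.symm.toAlgHom).comp (g.comp e.toAlgHom)

end Formal

section Quantum

variable {A : Type*} [CommRing A] [Algebra ℂ A]

/-- `R₂₁`. -/
def formal21 (R : A ⊗[ℂ] A →ₐ[ℂ] (A ⊗[ℂ] A)⟦X⟧) : A ⊗[ℂ] A →ₐ[ℂ] (A ⊗[ℂ] A)⟦X⟧ :=
  conjFormal (flip A) R

/-- `R₁₂ = R ⊗ 1`, the algebra homomorphism `F ⊗ c ↦ R(F) (1 ⊗ 1 ⊗ c)`. -/
def formal12 (R : A ⊗[ℂ] A →ₐ[ℂ] (A ⊗[ℂ] A)⟦X⟧) :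
    (A ⊗[ℂ] A) ⊗[ℂ] A →ₐ[ℂ] ((A ⊗[ℂ] A) ⊗[ℂ] A)⟦X⟧ :=
  Algebra.TensorProduct.productMap
    ((PowerSeries.mapAlgHom Algebra.TensorProduct.includeLeft).comp R)
    (oneFormal.comp Algebra.TensorProduct.includeRight)

/-- `R₁₃`. -/
def formal13 (R : A ⊗[ℂ] A →ₐ[ℂ] (A ⊗[ℂ] A)⟦X⟧) :
    (A ⊗[ℂ] A) ⊗[ℂ] A →ₐ[ℂ] ((A ⊗[ℂ] A) ⊗[ℂ] A)⟦X⟧ :=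
  conjFormal (swap23 A) (formal12 R)

/-- `R₂₃`. -/
def formal23 (R : A ⊗[ℂ] A →ₐ[ℂ] (A ⊗[ℂ] A)⟦X⟧) :
    (A ⊗[ℂ] A) ⊗[ℂ] A →ₐ[ℂ] ((A ⊗[ℂ] A) ⊗[ℂ] A)⟦X⟧ :=
  conjFormal (cyc A) (formal12 R)

/-- A geometric quantum R-matrix: a formal diffeomorphism of `X × X` satisfying the quantum
Yang–Baxter equation and unitarity. -/
structure IsQuantumRMatrix (R : A ⊗[ℂ] A →ₐ[ℂ] (A ⊗[ℂ] A)⟦X⟧) : Prop where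
  formal : IsFormalDiffeo R
  qybe : mulFormal (mulFormal (formal12 R) (formal13 R)) (formal23 R)
    = mulFormal (mulFormal (formal23 R) (formal13 R)) (formal12 R)
  unitarity : mulFormal R (formal21 R) = oneFormal

/-- `R` is a quantization of `r`: a geometric quantum R-matrix with `R = 1 + ħ r + O(ħ²)`. -/
structure IsQuantization (R : A ⊗[ℂ] A →ₐ[ℂ] (A ⊗[ℂ] A)⟦X⟧)
    (r : Derivation ℂ (A ⊗[ℂ] A) (A ⊗[ℂ] A)) : Prop extends IsQuantumRMatrix R where
  firstOrder : ∀ F : A ⊗[ℂ] A, PowerSeries.coeff 1 (R F) = r F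

end Quantum

end GeometricRMatrix

end

/-! At a point (x, y), unitarity gives `r` the form (φ_y(x), -φ_x(y)), where φ is a family of vector
fields on X parametrized by points of X. Evaluated on functions of the first coordinate, the
classical Yang–Baxter equation says that two vector fields on triples (u, v, w) commute: V, which
moves every coordinate along -φ_v, and W, which moves every coordinate along -φ_w
(`IsClassicalRMatrix.commute`). The parameter itself moves too.

Commuting fields have commuting flows. Let h(x, y) be the first coordinate of the time-ħ flow of
(-φ_y(x), -φ_y(y)). The flow of V sends (u, v, w) to (h(u, v), h(v, v), h(w, v)), and similarly for
W, so the first coordinate of the commutation relation is the cycle identity h(h(u, w), h(v, w)) =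
h(h(u, v), h(w, v)) (`IsClassicalRMatrix.exists_isCycleMap`).

The twist T(x, y) = (h(x, y), y) is invertible, being trivial modulo ħ, and R is the quotient of T₂₁
by T: it sends (h(x, y), y) to (x, h(y, x)). Unitarity is the symmetry of this description. The
quantum Yang–Baxter equation follows from three instances of the cycle identity
(`IsCycleMap.quotient_qybe`), and the ħ-term of R is read off from that of T.

A homomorphism `A →ₐ[ℂ] C⟦X⟧` is treated as a formal point of X with parameters in Spec C. Since
homomorphisms act on functions, a product of formal diffeomorphisms acts on points with its left
factor first. -/

noncomputable section

namespace GeometricRMatrix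

/-! ### Continuous extension to power series and formal inversion -/

section Extension

variable {B B' C : Type*} [CommRing B] [Algebra ℂ B] [CommRing B'] [Algebra ℂ B']
  [CommRing C] [Algebra ℂ C]

/-- The coefficients of `∑ g(F_j) ħ^j`. -/
def extendFun (g : B →ₐ[ℂ] C⟦X⟧) (F : B⟦X⟧) : C⟦X⟧ :=
  PowerSeries.mk fun n => ∑ p ∈ Finset.HasAntidiagonal.antidiagonal n,
    PowerSeries.coeff p.1 (g (PowerSeries.coeff p.2 F))

lemma extendFun_C (g : B →ₐ[ℂ] C⟦X⟧) (b : B) : extendFun g (PowerSeries.C b) = g b := by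
  ext n
  simp only [extendFun, PowerSeries.coeff_mk]
  rw [Finset.sum_eq_single (n, 0)]
  · simp
  · rintro ⟨i, j⟩ hij hne
    have hj : j ≠ 0 := by
      rintro rfl
      simp at hij
      simp [hij] at hne
    simp [PowerSeries.coeff_C, hj]
  · simp

lemma extendFun_mul (g : B →ₐ[ℂ] C⟦X⟧) (F G : B⟦X⟧) :
    extendFun g (F * G) = extendFun g F * extendFun g G := by
  ext n
  simp only [extendFun, PowerSeries.coeff_mk, PowerSeries.coeff_mul, map_sum, map_mul,
    Finset.sum_mul_sum]
  simp only [Finset.sum_sigma']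
  refine Finset.sum_nbij'
    (fun x => ⟨(x.2.2.1 + x.2.1.1, x.2.2.2 + x.2.1.2),
      ⟨(x.2.2.1, x.2.1.1), (x.2.2.2, x.2.1.2)⟩⟩)
    (fun y => ⟨(y.2.1.1 + y.2.2.1, y.2.1.2 + y.2.2.2),
      ⟨(y.2.1.2, y.2.2.2), (y.2.1.1, y.2.2.1)⟩⟩)
    ?_ ?_ ?_ ?_ ?_
  · rintro ⟨⟨i, j⟩, ⟨k, l⟩, ⟨p, q⟩⟩ h
    simp only [Finset.mem_sigma, Finset.HasAntidiagonal.mem_antidiagonal, and_true] at h ⊢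
    omega
  · rintro ⟨⟨i, j⟩, ⟨k, l⟩, ⟨p, q⟩⟩ h
    simp only [Finset.mem_sigma, Finset.HasAntidiagonal.mem_antidiagonal, and_true] at h ⊢
    omega
  · rintro ⟨⟨i, j⟩, ⟨k, l⟩, ⟨p, q⟩⟩ h
    simp only [Finset.mem_sigma, Finset.HasAntidiagonal.mem_antidiagonal] at h
    obtain ⟨-, rfl, rfl⟩ := h
    rfl
  · rintro ⟨⟨i, j⟩, ⟨k, l⟩, ⟨p, q⟩⟩ h
    simp only [Finset.mem_sigma, Finset.HasAntidiagonal.mem_antidiagonal] at h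
    obtain ⟨-, rfl, rfl⟩ := h
    rfl
  · intro x _
    rfl

/-- The `ħ`-adically continuous `ℂ[[ħ]]`-linear extension of `g : B → C[[ħ]]` to `B[[ħ]]`. -/
def extendHom (g : B →ₐ[ℂ] C⟦X⟧) : B⟦X⟧ →ₐ[ℂ] C⟦X⟧ where
  toFun := extendFun g
  map_one' := by rw [← map_one (PowerSeries.C (R := B)), extendFun_C]; simp
  map_mul' := extendFun_mul g
  map_zero' := by ext n; simp [extendFun]
  map_add' F G := by ext n; simp [extendFun, Finset.sum_add_distrib]
  commutes' c := by
    rw [PowerSeries.algebraMap_apply, extendFun_C, AlgHom.commutes, PowerSeries.algebraMap_apply]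

lemma coeff_extendHom (g : B →ₐ[ℂ] C⟦X⟧) (F : B⟦X⟧) (n : ℕ) :
    PowerSeries.coeff n (extendHom g F) = ∑ p ∈ Finset.HasAntidiagonal.antidiagonal n,
      PowerSeries.coeff p.1 (g (PowerSeries.coeff p.2 F)) := by
  change PowerSeries.coeff n (extendFun g F) = _
  rw [extendFun, PowerSeries.coeff_mk]

lemma hExt_eq_extendHom (g : B →ₐ[ℂ] B⟦X⟧) : hExt g = extendHom g := rfl

lemma coeff_zero_extendHom (g : B →ₐ[ℂ] C⟦X⟧) (F : B⟦X⟧) :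
    PowerSeries.coeff 0 (extendHom g F) = PowerSeries.coeff 0 (g (PowerSeries.coeff 0 F)) := by
  rw [coeff_extendHom]; simp

lemma coeff_one_extendHom (g : B →ₐ[ℂ] C⟦X⟧) (F : B⟦X⟧) :
    PowerSeries.coeff 1 (extendHom g F) = PowerSeries.coeff 0 (g (PowerSeries.coeff 1 F))
      + PowerSeries.coeff 1 (g (PowerSeries.coeff 0 F)) := by
  rw [coeff_extendHom]; simp [Finset.Nat.antidiagonal_succ]

lemma oneFormal_apply (b : B) : oneFormal b = PowerSeries.C b := rfl

@[simp] lemma extendHom_oneFormal_apply (g : B →ₐ[ℂ] C⟦X⟧) (b : B) :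
    extendHom g (oneFormal b) = g b :=
  extendFun_C g b

@[simp] lemma extendHom_comp_oneFormal (g : B →ₐ[ℂ] C⟦X⟧) :
    (extendHom g).comp oneFormal = g :=
  AlgHom.ext fun b => extendHom_oneFormal_apply g b

lemma coeff_mapAlgHom (f : B →ₐ[ℂ] C) (F : B⟦X⟧) (n : ℕ) :
    PowerSeries.coeff n (PowerSeries.mapAlgHom f F) = f (PowerSeries.coeff n F) := by
  rw [PowerSeries.mapAlgHom_apply, PowerSeries.coeff_map]; rfl

lemma extendHom_comp_mapAlgHom (g : B →ₐ[ℂ] C⟦X⟧) (f : B' →ₐ[ℂ] B) :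
    (extendHom g).comp (PowerSeries.mapAlgHom f) = extendHom (g.comp f) := by
  ext F n
  simp [coeff_extendHom, coeff_mapAlgHom]

lemma mapAlgHom_eq_extendHom (f : B →ₐ[ℂ] C) :
    PowerSeries.mapAlgHom f = extendHom (oneFormal.comp f) := by
  ext F n
  rw [coeff_extendHom, Finset.sum_eq_single (0, n)]
  · simp [oneFormal_apply, coeff_mapAlgHom]
  · rintro ⟨i, j⟩ hij hne
    have hj : i ≠ 0 := by
      rintro rfl
      simp at hij
      simp [hij] at hne
    simp [oneFormal_apply, PowerSeries.coeff_C, hj]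
  · simp

/-- Both sides sum over triples of exponents with total n. This is the associativity of composition
of formal maps. -/
lemma extendHom_comp_extendHom (g : B →ₐ[ℂ] C⟦X⟧) (f : B' →ₐ[ℂ] B⟦X⟧) :
    (extendHom g).comp (extendHom f) = extendHom ((extendHom g).comp f) := by
  ext F n
  simp only [AlgHom.comp_apply, coeff_extendHom, map_sum, Finset.sum_sigma']
  refine Finset.sum_nbij'
    (fun x => ⟨(x.1.1 + x.2.1, x.2.2), (x.1.1, x.2.1)⟩)
    (fun y => ⟨(y.2.1, y.2.2 + y.1.2), (y.2.2, y.1.2)⟩) ?_ ?_ ?_ ?_ ?_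
  · rintro ⟨⟨i, j⟩, ⟨k, l⟩⟩ h
    simp only [Finset.mem_sigma, Finset.HasAntidiagonal.mem_antidiagonal, and_true] at h ⊢
    omega
  · rintro ⟨⟨i, j⟩, ⟨k, l⟩⟩ h
    simp only [Finset.mem_sigma, Finset.HasAntidiagonal.mem_antidiagonal, and_true] at h ⊢
    omega
  · rintro ⟨⟨i, j⟩, ⟨k, l⟩⟩ h
    simp only [Finset.mem_sigma, Finset.HasAntidiagonal.mem_antidiagonal] at h
    obtain ⟨-, rfl⟩ := h
    rfl
  · rintro ⟨⟨i, j⟩, ⟨k, l⟩⟩ h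
    simp only [Finset.mem_sigma, Finset.HasAntidiagonal.mem_antidiagonal] at h
    obtain ⟨-, rfl⟩ := h
    rfl
  · intro x _
    rfl

/-- The solution `G` of `g(G) = F`, coefficient by coefficient. -/
def preimageCoeff (g : B →ₐ[ℂ] B⟦X⟧) (F : B⟦X⟧) : ℕ → B
  | n => PowerSeries.coeff n F
      - ∑ j : Fin n, PowerSeries.coeff (n - j) (g (preimageCoeff g F j))
  decreasing_by exact j.2

/-- Since g = 1 + O(ħ), the equation g(F) = G is a triangular system with identity diagonal for the
coefficients of F. Injectivity and surjectivity both follow by recursion on n. -/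
lemma coeff_extendHom_of_formal {g : B →ₐ[ℂ] B⟦X⟧} (hg : IsFormalDiffeo g) (F : B⟦X⟧) (n : ℕ) :
    PowerSeries.coeff n (extendHom g F) = PowerSeries.coeff n F
      + ∑ j : Fin n, PowerSeries.coeff (n - j) (g (PowerSeries.coeff j F)) := by
  rw [coeff_extendHom, ← Finset.Nat.sum_antidiagonal_swap,
    Finset.Nat.sum_antidiagonal_eq_sum_range_succ_mk, Finset.sum_range_succ,
    add_comm]
  simp only [Prod.fst_swap, Prod.snd_swap, Nat.sub_self, hg _]
  rw [Fin.sum_univ_eq_sum_range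
    (fun j => PowerSeries.coeff (n - j) (g (PowerSeries.coeff j F)))]

lemma extendHom_injective {g : B →ₐ[ℂ] B⟦X⟧} (hg : IsFormalDiffeo g) :
    Function.Injective (extendHom g) := by
  intro F G h
  ext n
  induction n using Nat.strong_induction_on with
  | _ n ih =>
    have h1 := congrArg (PowerSeries.coeff n) h
    rw [coeff_extendHom_of_formal hg, coeff_extendHom_of_formal hg,
      Finset.sum_congr rfl fun j _ => by rw [ih j j.2]] at h1
    exact add_right_cancel h1

lemma extendHom_surjective {g : B →ₐ[ℂ] B⟦X⟧} (hg : IsFormalDiffeo g) :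
    Function.Surjective (extendHom g) := by
  intro F
  refine ⟨PowerSeries.mk (preimageCoeff g F), ?_⟩
  ext n
  rw [coeff_extendHom_of_formal hg]
  simp only [PowerSeries.coeff_mk]
  conv_lhs => enter [1]; rw [preimageCoeff]
  simp

lemma exists_comp_eq_of_formal {g : B →ₐ[ℂ] B⟦X⟧} (hg : IsFormalDiffeo g) (f : B →ₐ[ℂ] B⟦X⟧) :
    ∃ R : B →ₐ[ℂ] B⟦X⟧, (extendHom g).comp R = f := by
  let e := AlgEquiv.ofBijective (extendHom g) ⟨extendHom_injective hg, extendHom_surjective hg⟩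
  exact ⟨e.symm.toAlgHom.comp f, AlgHom.ext fun b => e.apply_symm_apply (f b)⟩

end Extension

/-! ### Formal flows of vector fields -/

section Exponential

variable {B C : Type*} [CommRing B] [Algebra ℂ B] [CommRing C] [Algebra ℂ C]

/-- Multiplication B ⊗ B → B intertwines Q ⊗ 1 + 1 ⊗ Q with Q. The two summands commute, so the
higher Leibniz rule is the binomial theorem. -/
lemma Derivation.pow_apply_mul (Q : Derivation ℂ B B) (n : ℕ) (a b : B) :
    (Q.toLinearMap ^ n) (a * b) = ∑ p ∈ Finset.HasAntidiagonal.antidiagonal n,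
      n.choose p.1 • ((Q.toLinearMap ^ p.1) a * (Q.toLinearMap ^ p.2) b) := by
  let S : Module.End ℂ (B ⊗[ℂ] B) := LinearMap.rTensor B Q.toLinearMap
  let T : Module.End ℂ (B ⊗[ℂ] B) := LinearMap.lTensor B Q.toLinearMap
  have hST : Commute S T := by
    refine TensorProduct.ext' fun x y => ?_
    simp [S, T]
  have hS (i : ℕ) (x y : B) : (S ^ i) (x ⊗ₜ y) = (Q.toLinearMap ^ i) x ⊗ₜ y := by
    rw [LinearMap.rTensor_pow, LinearMap.rTensor_tmul]
  have hT (i : ℕ) (x y : B) : (T ^ i) (x ⊗ₜ y) = x ⊗ₜ (Q.toLinearMap ^ i) y := by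
    rw [LinearMap.lTensor_pow, LinearMap.lTensor_tmul]
  have hmul (z : B ⊗[ℂ] B) :
      Q.toLinearMap (LinearMap.mul' ℂ B z) = LinearMap.mul' ℂ B ((S + T) z) := by
    induction z with
    | zero => simp
    | add x y hx hy => rw [map_add, map_add, hx, hy, map_add, map_add]
    | tmul x y => simp [S, T]; ring
  have hpow (k : ℕ) (z : B ⊗[ℂ] B) :
      (Q.toLinearMap ^ k) (LinearMap.mul' ℂ B z) = LinearMap.mul' ℂ B (((S + T) ^ k) z) := by
    induction k with
    | zero => simp
    | succ k ih => rw [pow_succ', Module.End.mul_apply, ih, hmul, pow_succ', Module.End.mul_apply]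
  have := hpow n (a ⊗ₜ b)
  rw [LinearMap.mul'_apply, hST.add_pow'] at this
  rw [this]
  simp only [LinearMap.sum_apply, LinearMap.smul_apply, Module.End.mul_apply, hS, hT, map_sum,
    map_nsmul, LinearMap.mul'_apply]

/-- The linear map `∑ ħⁿ Qⁿ / n!`. -/
def expLinearMap (Q : Module.End ℂ B) : B →ₗ[ℂ] B⟦X⟧ where
  toFun b := PowerSeries.mk fun n => ((n.factorial : ℂ)⁻¹) • (Q ^ n) b
  map_add' a b := by ext n; simp
  map_smul' c b := by ext n; simp [smul_comm c]

lemma coeff_expLinearMap (Q : Module.End ℂ B) (b : B) (n : ℕ) :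
    PowerSeries.coeff n (expLinearMap Q b) = ((n.factorial : ℂ)⁻¹) • (Q ^ n) b := by
  simp [expLinearMap]

/-- The flow `exp(ħ Q) = ∑ ħⁿ Qⁿ / n!` of a vector field `Q`. -/
def expHom (Q : Derivation ℂ B B) : B →ₐ[ℂ] B⟦X⟧ := by
  refine AlgHom.ofLinearMap (expLinearMap Q.toLinearMap) ?_ fun a b => ?_
  · ext n
    cases n with
    | zero => simp [coeff_expLinearMap]
    | succ n => simp [coeff_expLinearMap, pow_succ, PowerSeries.coeff_one]
  ext n
  simp only [coeff_expLinearMap, PowerSeries.coeff_mul,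
    Derivation.pow_apply_mul, Finset.smul_sum]
  refine Finset.sum_congr rfl fun p hp => ?_
  rw [Finset.HasAntidiagonal.mem_antidiagonal] at hp
  rw [smul_mul_smul_comm, ← Nat.cast_smul_eq_nsmul ℂ, smul_smul]
  congr 1
  subst hp
  have h1 : ((p.1 + p.2).factorial : ℂ) ≠ 0 := by exact_mod_cast Nat.factorial_ne_zero _
  have h2 : (p.1.factorial : ℂ) ≠ 0 := by exact_mod_cast Nat.factorial_ne_zero _
  have h3 : (p.2.factorial : ℂ) ≠ 0 := by exact_mod_cast Nat.factorial_ne_zero _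
  have h4 : ((p.1 + p.2).choose p.1 : ℂ) * p.1.factorial * p.2.factorial
      = (p.1 + p.2).factorial := by
    rw [Nat.choose_symm_add]
    exact_mod_cast Nat.add_choose_mul_factorial_mul_factorial p.1 p.2
  field_simp
  rw [← h4]

lemma coeff_expHom (Q : Derivation ℂ B B) (b : B) (n : ℕ) :
    PowerSeries.coeff n (expHom Q b) = ((n.factorial : ℂ)⁻¹) • (Q.toLinearMap ^ n) b :=
  coeff_expLinearMap _ _ _

lemma coeff_zero_expHom (Q : Derivation ℂ B B) (b : B) :
    PowerSeries.coeff 0 (expHom Q b) = b := by simp [coeff_expHom]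

lemma coeff_one_expHom (Q : Derivation ℂ B B) (b : B) :
    PowerSeries.coeff 1 (expHom Q b) = Q b := by simp [coeff_expHom]

/-- Flows are natural: a map that relates two vector fields relates all their powers, hence their
exponentials. -/
lemma expHom_comp_of_intertwines {Q : Derivation ℂ B B} {Q' : Derivation ℂ C C} {s : B →ₐ[ℂ] C}
    (h : ∀ b, s (Q b) = Q' (s b)) :
    (expHom Q').comp s = (PowerSeries.mapAlgHom s).comp (expHom Q) := by
  ext b n
  simp only [AlgHom.comp_apply, coeff_mapAlgHom, coeff_expHom, map_smul]
  congr 1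
  induction n with
  | zero => simp
  | succ n ih => simp [pow_succ', ih, h]

lemma extendHom_expHom_comm {Q Q' : Derivation ℂ B B} (h : ∀ b, Q (Q' b) = Q' (Q b)) :
    (extendHom (expHom Q)).comp (expHom Q') = (extendHom (expHom Q')).comp (expHom Q) := by
  have hc : Commute Q.toLinearMap Q'.toLinearMap := LinearMap.ext h
  ext b n
  simp only [AlgHom.comp_apply, coeff_extendHom]
  rw [← Finset.Nat.sum_antidiagonal_swap]
  refine Finset.sum_congr rfl fun p _ => ?_
  simp only [coeff_expHom, map_smul, LinearMap.map_smul_of_tower, Prod.fst_swap, Prod.snd_swap]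
  rw [smul_comm]
  congr 2
  exact LinearMap.congr_fun (hc.pow_pow p.2 p.1) b

end Exponential

/-! ### Derivations along a homomorphism, and tensor products -/

section DerivationsAlong

variable {A B K K' : Type*} [CommRing A] [Algebra ℂ A] [CommRing B] [Algebra ℂ B]
  [CommRing K] [Algebra ℂ K] [CommRing K'] [Algebra ℂ K']

open Algebra.TensorProduct

/-- `d` is a derivation along the homomorphism `f`. -/
def IsDerivationAlong (f : A →ₐ[ℂ] K) (d : A →ₗ[ℂ] K) : Prop :=
  ∀ a b, d (a * b) = f a * d b + f b * d a

lemma IsDerivationAlong.map_one {f : A →ₐ[ℂ] K} {d : A →ₗ[ℂ] K} (h : IsDerivationAlong f d) :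
    d 1 = 0 := by
  simpa using h 1 1

lemma Derivation.isDerivationAlong_comp_right (Q : Derivation ℂ K K) (f : A →ₐ[ℂ] K) :
    IsDerivationAlong f (Q.toLinearMap ∘ₗ f.toLinearMap) := fun a b => by simp

lemma Derivation.isDerivationAlong_id (Q : Derivation ℂ K K) :
    IsDerivationAlong (AlgHom.id ℂ K) Q.toLinearMap :=
  Derivation.isDerivationAlong_comp_right Q (AlgHom.id ℂ K)

lemma IsDerivationAlong.comp_left {f : A →ₐ[ℂ] K} {d : A →ₗ[ℂ] K} (h : IsDerivationAlong f d)
    (s : K →ₐ[ℂ] K') : IsDerivationAlong (s.comp f) (s.toLinearMap ∘ₗ d) := fun a b => by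
  simp [h a b]

lemma IsDerivationAlong.add {f : A →ₐ[ℂ] K} {d d' : A →ₗ[ℂ] K} (h : IsDerivationAlong f d)
    (h' : IsDerivationAlong f d') : IsDerivationAlong f (d + d') := fun a b => by
  simp [h a b, h' a b]; ring

lemma IsDerivationAlong.neg {f : A →ₐ[ℂ] K} {d : A →ₗ[ℂ] K} (h : IsDerivationAlong f d) :
    IsDerivationAlong f (-d) := fun a b => by
  simp [h a b]; ring

/-- A derivation along the identity, as a derivation. -/
def IsDerivationAlong.toDerivation {d : K →ₗ[ℂ] K} (h : IsDerivationAlong (AlgHom.id ℂ K) d) :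
    Derivation ℂ K K :=
  Derivation.mk' d fun a b => by simpa using h a b

lemma IsDerivationAlong.tensor_ext {f : A ⊗[ℂ] B →ₐ[ℂ] K} {d d' : A ⊗[ℂ] B →ₗ[ℂ] K}
    (h : IsDerivationAlong f d) (h' : IsDerivationAlong f d')
    (hl : ∀ a, d (a ⊗ₜ 1) = d' (a ⊗ₜ 1)) (hr : ∀ b, d (1 ⊗ₜ b) = d' (1 ⊗ₜ b)) : d = d' := by
  refine TensorProduct.ext' fun a b => ?_
  have e : a ⊗ₜ[ℂ] b = (a ⊗ₜ 1) * (1 ⊗ₜ b) := by simp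
  rw [e, h, h', hl, hr]

/-- A tangent vector to a product is a pair of tangent vectors: the Leibniz rule dictates d(a ⊗ b),
and the two given rules make it consistent. -/
lemma IsDerivationAlong.exists_tensor {f : A ⊗[ℂ] B →ₐ[ℂ] K} {d₁ : A →ₗ[ℂ] K} {d₂ : B →ₗ[ℂ] K}
    (h₁ : IsDerivationAlong (f.comp includeLeft) d₁)
    (h₂ : IsDerivationAlong (f.comp includeRight) d₂) :
    ∃ d : A ⊗[ℂ] B →ₗ[ℂ] K, IsDerivationAlong f d ∧ (∀ a, d (a ⊗ₜ 1) = d₁ a) ∧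
      ∀ b, d (1 ⊗ₜ b) = d₂ b := by
  let fl : A →ₗ[ℂ] K := (f.comp includeLeft).toLinearMap
  let fr : B →ₗ[ℂ] K := (f.comp includeRight).toLinearMap
  let d : A ⊗[ℂ] B →ₗ[ℂ] K := TensorProduct.lift
    ((LinearMap.mul ℂ K).compl₁₂ d₁ fr + (LinearMap.mul ℂ K).compl₁₂ fl d₂)
  have hd (a : A) (b : B) : d (a ⊗ₜ b) = d₁ a * f (1 ⊗ₜ b) + f (a ⊗ₜ 1) * d₂ b := by
    simp [d, fl, fr]
  have hf (a : A) (b : B) : f (a ⊗ₜ b) = f (a ⊗ₜ 1) * f (1 ⊗ₜ b) := by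
    rw [← map_mul]; simp
  refine ⟨d, fun x y => ?_, fun a => ?_, fun b => ?_⟩
  · induction x with
    | zero => simp
    | add x x' hx hx' => rw [add_mul, map_add, hx, hx', map_add, map_add]; ring
    | tmul a b =>
      induction y with
      | zero => simp
      | add y y' hy hy' => rw [mul_add, map_add, hy, hy', map_add, map_add]; ring
      | tmul a' b' =>
        have e1 := h₁ a a'
        have e2 := h₂ b b'
        have e3 : f ((a * a') ⊗ₜ 1) = f (a ⊗ₜ 1) * f (a' ⊗ₜ 1) := by rw [← map_mul]; simp
        have e4 : f (1 ⊗ₜ (b * b')) = f (1 ⊗ₜ b) * f (1 ⊗ₜ b') := by rw [← map_mul]; simp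
        simp only [AlgHom.comp_apply, includeLeft_apply, includeRight_apply] at e1 e2
        rw [tmul_mul_tmul, hd, hd, hd, e1, e2, hf a b, hf a' b', e3, e4]
        ring
  · simp [hd, h₂.map_one, ← one_def]
  · simp [hd, h₁.map_one, ← one_def]

end DerivationsAlong

/-! ### Vector fields that move all points along -φ_y -/

section Flows

variable {A K K' : Type*} [CommRing A] [Algebra ℂ A] [CommRing K] [Algebra ℂ K]
  [CommRing K'] [Algebra ℂ K']

open Algebra.TensorProduct

/-- The vector field `Q` moves the point `x` along `-φ_y`, where `D` is the family `φ` of vector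
fields parametrized by points. -/
def MovesAlong (D : A →ₗ[ℂ] A ⊗[ℂ] A) (Q : Derivation ℂ K K) (y x : A →ₐ[ℂ] K) : Prop :=
  ∀ a, Q (x a) = -productMap x y (D a)

lemma comp_productMap (s : K →ₐ[ℂ] K') (x y : A →ₐ[ℂ] K) :
    s.comp (productMap x y) = productMap (s.comp x) (s.comp y) := by
  ext <;> simp

lemma productMap_comp_flip (x y : A →ₐ[ℂ] K) :
    (productMap x y).comp (flip A).toAlgHom = productMap y x := by
  ext <;> simp

lemma productMap_flip (x y : A →ₐ[ℂ] K) (F : A ⊗[ℂ] A) :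
    productMap x y (flip A F) = productMap y x F :=
  AlgHom.congr_fun (productMap_comp_flip x y) F

lemma isDerivationAlong_productMap {D : A →ₗ[ℂ] A ⊗[ℂ] A}
    (hD : IsDerivationAlong includeLeft D) (x y : A →ₐ[ℂ] K) :
    IsDerivationAlong x (-((productMap x y).toLinearMap ∘ₗ D)) := by
  have h := (hD.comp_left (productMap x y)).neg
  rwa [productMap_left] at h

lemma exists_movesAlong_two {D : A →ₗ[ℂ] A ⊗[ℂ] A} (hD : IsDerivationAlong includeLeft D) :
    ∃ Q : Derivation ℂ (A ⊗[ℂ] A) (A ⊗[ℂ] A), MovesAlong D Q includeRight includeLeft ∧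
      MovesAlong D Q includeRight includeRight := by
  have h₁ := isDerivationAlong_productMap hD
    (includeLeft : A →ₐ[ℂ] A ⊗[ℂ] A) (includeRight : A →ₐ[ℂ] A ⊗[ℂ] A)
  have h₂ := isDerivationAlong_productMap hD
    (includeRight : A →ₐ[ℂ] A ⊗[ℂ] A) (includeRight : A →ₐ[ℂ] A ⊗[ℂ] A)
  rw [← AlgHom.id_comp (includeLeft : A →ₐ[ℂ] A ⊗[ℂ] A)] at h₁
  rw [← AlgHom.id_comp (includeRight : A →ₐ[ℂ] A ⊗[ℂ] A)] at h₂
  obtain ⟨d, hd, hl, hr⟩ := IsDerivationAlong.exists_tensor h₁ h₂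
  exact ⟨hd.toDerivation, hl, hr⟩

/-- Functions of the first point of `X × X × X`. -/
def leg₁ : A →ₐ[ℂ] (A ⊗[ℂ] A) ⊗[ℂ] A :=
  (includeLeft : A ⊗[ℂ] A →ₐ[ℂ] (A ⊗[ℂ] A) ⊗[ℂ] A).comp includeLeft

/-- Functions of the second point of `X × X × X`. -/
def leg₂ : A →ₐ[ℂ] (A ⊗[ℂ] A) ⊗[ℂ] A :=
  (includeLeft : A ⊗[ℂ] A →ₐ[ℂ] (A ⊗[ℂ] A) ⊗[ℂ] A).comp includeRight

/-- Functions of the third point of `X × X × X`. -/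
def leg₃ : A →ₐ[ℂ] (A ⊗[ℂ] A) ⊗[ℂ] A := includeRight

lemma leg₁_apply (a : A) : leg₁ a = (a ⊗ₜ[ℂ] 1) ⊗ₜ[ℂ] (1 : A) := rfl
lemma leg₂_apply (a : A) : leg₂ a = ((1 : A) ⊗ₜ[ℂ] a) ⊗ₜ[ℂ] (1 : A) := rfl
lemma leg₃_apply (a : A) : leg₃ a = ((1 : A) ⊗ₜ[ℂ] (1 : A)) ⊗ₜ[ℂ] a := rfl

lemma tmul_eq_legs (a b c : A) : (a ⊗ₜ[ℂ] b) ⊗ₜ[ℂ] c = leg₁ a * leg₂ b * leg₃ c := by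
  simp [leg₁_apply, leg₂_apply, leg₃_apply]

lemma IsDerivationAlong.legs_ext {f : (A ⊗[ℂ] A) ⊗[ℂ] A →ₐ[ℂ] K}
    {d d' : (A ⊗[ℂ] A) ⊗[ℂ] A →ₗ[ℂ] K}
    (h : IsDerivationAlong f d) (h' : IsDerivationAlong f d')
    (h₁ : ∀ a, d (leg₁ a) = d' (leg₁ a)) (h₂ : ∀ a, d (leg₂ a) = d' (leg₂ a))
    (h₃ : ∀ a, d (leg₃ a) = d' (leg₃ a)) : d = d' := by
  refine TensorProduct.ext_threefold fun a b c => ?_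
  rw [tmul_eq_legs, h, h', h, h', h₁, h₂, h₃]

/-- The components of a vector field on X × X × X can be prescribed separately, so `exists_tensor`
is applied twice. The parameter y will be the second or the third coordinate. -/
lemma exists_movesAlong_three {D : A →ₗ[ℂ] A ⊗[ℂ] A} (hD : IsDerivationAlong includeLeft D)
    (y : A →ₐ[ℂ] (A ⊗[ℂ] A) ⊗[ℂ] A) :
    ∃ Q : Derivation ℂ ((A ⊗[ℂ] A) ⊗[ℂ] A) ((A ⊗[ℂ] A) ⊗[ℂ] A), MovesAlong D Q y leg₁ ∧
      MovesAlong D Q y leg₂ ∧ MovesAlong D Q y leg₃ := by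
  -- The values on the first two factors may involve the third one through y, so this is a
  -- derivation along the inclusion and not one of `A ⊗[ℂ] A`.
  obtain ⟨e, he, h₁, h₂⟩ := IsDerivationAlong.exists_tensor
    (f := (includeLeft : A ⊗[ℂ] A →ₐ[ℂ] (A ⊗[ℂ] A) ⊗[ℂ] A))
    (isDerivationAlong_productMap hD leg₁ y) (isDerivationAlong_productMap hD leg₂ y)
  obtain ⟨d, hd, hl, h₃⟩ := IsDerivationAlong.exists_tensor
    (f := AlgHom.id ℂ ((A ⊗[ℂ] A) ⊗[ℂ] A)) he (isDerivationAlong_productMap hD leg₃ y)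
  exact ⟨hd.toDerivation, fun a => (hl _).trans (h₁ a), fun a => (hl _).trans (h₂ a), h₃⟩

/-- A homomorphism that moves along with the points intertwines the vector fields. -/
lemma intertwines_two {D : A →ₗ[ℂ] A ⊗[ℂ] A} {Q : Derivation ℂ (A ⊗[ℂ] A) (A ⊗[ℂ] A)}
    (hl : MovesAlong D Q includeRight includeLeft)
    (hr : MovesAlong D Q includeRight includeRight) {Q' : Derivation ℂ K K} {x y : A →ₐ[ℂ] K}
    (hx : MovesAlong D Q' y x) (hy : MovesAlong D Q' y y) (F : A ⊗[ℂ] A) :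
    productMap x y (Q F) = Q' (productMap x y F) := by
  have hl' (a : A) := congrArg (productMap x y) (hl a)
  have hr' (a : A) := congrArg (productMap x y) (hr a)
  simp only [map_neg, ← AlgHom.comp_apply, comp_productMap, productMap_left, productMap_right]
    at hl' hr'
  refine LinearMap.congr_fun (IsDerivationAlong.tensor_ext (f := productMap x y)
    (d := (productMap x y).toLinearMap ∘ₗ Q.toLinearMap)
    (d' := Q'.toLinearMap ∘ₗ (productMap x y).toLinearMap) ?_
    (Derivation.isDerivationAlong_comp_right _ _) (fun a => ?_) fun b => ?_) F
  · simpa using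
      (Derivation.isDerivationAlong_id Q).comp_left (productMap x y)
  · simpa using (hl' a).trans (hx a).symm
  · simpa using (hr' b).trans (hy b).symm

/-- Both composites are derivations along s, so they need comparing only on the three legs. There s
merely substitutes points into the expression for -φ_y. -/
lemma intertwines_three {D : A →ₗ[ℂ] A ⊗[ℂ] A}
    {Q : Derivation ℂ ((A ⊗[ℂ] A) ⊗[ℂ] A) ((A ⊗[ℂ] A) ⊗[ℂ] A)}
    {y : A →ₐ[ℂ] (A ⊗[ℂ] A) ⊗[ℂ] A}
    (h₁ : MovesAlong D Q y leg₁) (h₂ : MovesAlong D Q y leg₂) (h₃ : MovesAlong D Q y leg₃)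
    {Q' : Derivation ℂ K K} (s : (A ⊗[ℂ] A) ⊗[ℂ] A →ₐ[ℂ] K)
    (k₁ : MovesAlong D Q' (s.comp y) (s.comp leg₁))
    (k₂ : MovesAlong D Q' (s.comp y) (s.comp leg₂))
    (k₃ : MovesAlong D Q' (s.comp y) (s.comp leg₃)) (F : (A ⊗[ℂ] A) ⊗[ℂ] A) :
    s (Q F) = Q' (s F) := by
  have key {x : A →ₐ[ℂ] (A ⊗[ℂ] A) ⊗[ℂ] A} (h : MovesAlong D Q y x)
      (k : MovesAlong D Q' (s.comp y) (s.comp x)) (a : A) : s (Q (x a)) = Q' (s (x a)) := by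
    rw [h a, map_neg, ← AlgHom.comp_apply, comp_productMap, ← k a, AlgHom.comp_apply]
  refine LinearMap.congr_fun (IsDerivationAlong.legs_ext (f := s)
    (d := s.toLinearMap ∘ₗ Q.toLinearMap) (d' := Q'.toLinearMap ∘ₗ s.toLinearMap) ?_
    (Derivation.isDerivationAlong_comp_right _ _) (key h₁ k₁) (key h₂ k₂) (key h₃ k₃)) F
  simpa using (Derivation.isDerivationAlong_id Q).comp_left s

end Flows

/-! ### The classical Yang–Baxter equation as commutation of vector fields -/

section ClassicalYangBaxter

variable {A : Type*} [CommRing A] [Algebra ℂ A]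

open Algebra.TensorProduct

/-- The family `φ` of vector fields on the first factor parametrized by the second one. -/
def firstComponent (r : Derivation ℂ (A ⊗[ℂ] A) (A ⊗[ℂ] A)) : A →ₗ[ℂ] A ⊗[ℂ] A :=
  r.toLinearMap ∘ₗ (includeLeft : A →ₐ[ℂ] A ⊗[ℂ] A).toLinearMap

lemma isDerivationAlong_firstComponent (r : Derivation ℂ (A ⊗[ℂ] A) (A ⊗[ℂ] A)) :
    IsDerivationAlong includeLeft (firstComponent r) :=
  Derivation.isDerivationAlong_comp_right r includeLeft

lemma IsClassicalRMatrix.apply_right {r : Derivation ℂ (A ⊗[ℂ] A) (A ⊗[ℂ] A)}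
    (hr : IsClassicalRMatrix r) (b : A) :
    r (1 ⊗ₜ b) = -flip A (firstComponent r b) := by
  have h := congrArg (flip A) (LinearMap.congr_fun hr.unitarity (b ⊗ₜ 1))
  simp only [op21, conjEnd, LinearMap.add_apply, LinearMap.comp_apply, map_add,
    LinearMap.zero_apply, map_zero] at h
  change flip A (firstComponent r b) + flip A ((flip A).symm (r (flip A (b ⊗ₜ 1)))) = 0 at h
  rw [AlgEquiv.apply_symm_apply, flip_tmul] at h
  exact eq_neg_of_add_eq_zero_right h

lemma isDerivationAlong_op12 (r : Derivation ℂ (A ⊗[ℂ] A) (A ⊗[ℂ] A)) :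
    IsDerivationAlong (AlgHom.id ℂ ((A ⊗[ℂ] A) ⊗[ℂ] A)) (op12 r.toLinearMap) := by
  intro x y
  induction x with
  | zero => simp
  | add x x' hx hx' => rw [add_mul, map_add, hx, hx', map_add, map_add]; ring
  | tmul a b =>
    induction y with
    | zero => simp
    | add y y' hy hy' => rw [mul_add, map_add, hy, hy', map_add, map_add]; ring
    | tmul a' b' =>
      simp [op12, TensorProduct.add_tmul, mul_comm b b']

lemma isDerivationAlong_conjEnd {B : Type*} [CommRing B] [Algebra ℂ B] (e : B ≃ₐ[ℂ] B)
    {d : Module.End ℂ B} (h : IsDerivationAlong (AlgHom.id ℂ B) d) :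
    IsDerivationAlong (AlgHom.id ℂ B) (conjEnd e d) := fun a b => by
  have := h (e a) (e b)
  simp only [AlgHom.id_apply] at this
  simp [conjEnd, this]

lemma op12_leg₁ (r : Derivation ℂ (A ⊗[ℂ] A) (A ⊗[ℂ] A)) (a : A) :
    op12 r.toLinearMap (leg₁ a) = productMap leg₁ leg₂ (firstComponent r a) := by
  have h : (includeLeft : A ⊗[ℂ] A →ₐ[ℂ] (A ⊗[ℂ] A) ⊗[ℂ] A) = productMap leg₁ leg₂ := by
    ext <;> simp [leg₁_apply, leg₂_apply]
  rw [← h]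
  rfl

lemma op12_leg₂ {r : Derivation ℂ (A ⊗[ℂ] A) (A ⊗[ℂ] A)} (hr : IsClassicalRMatrix r) (a : A) :
    op12 r.toLinearMap (leg₂ a) = -productMap leg₂ leg₁ (firstComponent r a) := by
  have h : (includeLeft : A ⊗[ℂ] A →ₐ[ℂ] (A ⊗[ℂ] A) ⊗[ℂ] A) = productMap leg₁ leg₂ := by
    ext <;> simp [leg₁_apply, leg₂_apply]
  rw [← productMap_flip, ← map_neg, ← hr.apply_right, ← h]
  rfl

lemma op12_leg₃ (r : Derivation ℂ (A ⊗[ℂ] A) (A ⊗[ℂ] A)) (a : A) :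
    op12 r.toLinearMap (leg₃ a) = 0 := by
  simp [op12, leg₃_apply, ← one_def]

lemma swap23_symm_comp_productMap (x y : A →ₐ[ℂ] (A ⊗[ℂ] A) ⊗[ℂ] A) (F : A ⊗[ℂ] A) :
    (swap23 A).symm (productMap x y F) = productMap ((swap23 A).symm.toAlgHom.comp x)
      ((swap23 A).symm.toAlgHom.comp y) F :=
  AlgHom.congr_fun (comp_productMap (swap23 A).symm.toAlgHom x y) F

lemma cyc_symm_comp_productMap (x y : A →ₐ[ℂ] (A ⊗[ℂ] A) ⊗[ℂ] A) (F : A ⊗[ℂ] A) :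
    (cyc A).symm (productMap x y F) = productMap ((cyc A).symm.toAlgHom.comp x)
      ((cyc A).symm.toAlgHom.comp y) F :=
  AlgHom.congr_fun (comp_productMap (cyc A).symm.toAlgHom x y) F

lemma swap23_symm_comp_legs : (swap23 A).symm.toAlgHom.comp leg₁ = leg₁ ∧
    (swap23 A).symm.toAlgHom.comp leg₂ = leg₃ ∧ (swap23 A).symm.toAlgHom.comp leg₃ = leg₂ :=
  ⟨rfl, rfl, rfl⟩

lemma cyc_symm_comp_legs : (cyc A).symm.toAlgHom.comp leg₁ = leg₂ ∧
    (cyc A).symm.toAlgHom.comp leg₂ = leg₃ ∧ (cyc A).symm.toAlgHom.comp leg₃ = leg₁ :=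
  ⟨rfl, rfl, rfl⟩

lemma op13_apply (r : Module.End ℂ (A ⊗[ℂ] A)) (F : (A ⊗[ℂ] A) ⊗[ℂ] A) :
    op13 r F = (swap23 A).symm (op12 r (swap23 A F)) := rfl

lemma op23_apply (r : Module.End ℂ (A ⊗[ℂ] A)) (F : (A ⊗[ℂ] A) ⊗[ℂ] A) :
    op23 r F = (cyc A).symm (op12 r (cyc A F)) := rfl

lemma swap23_legs (a : A) : swap23 A (leg₁ a) = leg₁ a ∧ swap23 A (leg₂ a) = leg₃ a ∧
    swap23 A (leg₃ a) = leg₂ a := ⟨rfl, rfl, rfl⟩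

lemma cyc_legs (a : A) : cyc A (leg₁ a) = leg₃ a ∧ cyc A (leg₂ a) = leg₁ a ∧
    cyc A (leg₃ a) = leg₂ a := ⟨rfl, rfl, rfl⟩

lemma op13_leg₁ (r : Derivation ℂ (A ⊗[ℂ] A) (A ⊗[ℂ] A)) (a : A) :
    op13 r.toLinearMap (leg₁ a) = productMap leg₁ leg₃ (firstComponent r a) := by
  rw [op13_apply, (swap23_legs a).1, op12_leg₁, swap23_symm_comp_productMap,
    swap23_symm_comp_legs.1, swap23_symm_comp_legs.2.1]

lemma op13_leg₂ (r : Derivation ℂ (A ⊗[ℂ] A) (A ⊗[ℂ] A)) (a : A) :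
    op13 r.toLinearMap (leg₂ a) = 0 := by
  rw [op13_apply, (swap23_legs a).2.1, op12_leg₃, map_zero]

lemma op23_leg₁ (r : Derivation ℂ (A ⊗[ℂ] A) (A ⊗[ℂ] A)) (a : A) :
    op23 r.toLinearMap (leg₁ a) = 0 := by
  rw [op23_apply, (cyc_legs a).1, op12_leg₃, map_zero]

lemma op23_leg₂ (r : Derivation ℂ (A ⊗[ℂ] A) (A ⊗[ℂ] A)) (a : A) :
    op23 r.toLinearMap (leg₂ a) = productMap leg₂ leg₃ (firstComponent r a) := by
  rw [op23_apply, (cyc_legs a).2.1, op12_leg₁, cyc_symm_comp_productMap,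
    cyc_symm_comp_legs.1, cyc_symm_comp_legs.2.1]

lemma op23_leg₃ {r : Derivation ℂ (A ⊗[ℂ] A) (A ⊗[ℂ] A)} (hr : IsClassicalRMatrix r) (a : A) :
    op23 r.toLinearMap (leg₃ a) = -productMap leg₃ leg₂ (firstComponent r a) := by
  rw [op23_apply, (cyc_legs a).2.2, op12_leg₂ hr, map_neg, cyc_symm_comp_productMap,
    cyc_symm_comp_legs.1, cyc_symm_comp_legs.2.1]

/-- If two derivations agree on two coordinates, they agree on functions of these coordinates. -/
lemma derivation_eq_on_productMap {K : Type*} [CommRing K] [Algebra ℂ K]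
    {d d' : K →ₗ[ℂ] K} (h : IsDerivationAlong (AlgHom.id ℂ K) d)
    (h' : IsDerivationAlong (AlgHom.id ℂ K) d') {x y : A →ₐ[ℂ] K}
    (hx : ∀ a, d (x a) = d' (x a)) (hy : ∀ a, d (y a) = d' (y a)) (F : A ⊗[ℂ] A) :
    d (productMap x y F) = d' (productMap x y F) := by
  induction F with
  | zero => simp
  | add F G hF hG => rw [map_add, map_add, map_add, hF, hG]
  | tmul a b => rw [productMap_apply_tmul, h, h', hx, hy]

/-- The classical Yang–Baxter equation says that the vector fields `φ_v` and `φ_w`, acting on all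
coordinates, commute. -/
lemma IsClassicalRMatrix.commute {r : Derivation ℂ (A ⊗[ℂ] A) (A ⊗[ℂ] A)}
    (hr : IsClassicalRMatrix r)
    {P Q : Derivation ℂ ((A ⊗[ℂ] A) ⊗[ℂ] A) ((A ⊗[ℂ] A) ⊗[ℂ] A)}
    (p₁ : MovesAlong (firstComponent r) P leg₂ leg₁)
    (p₂ : MovesAlong (firstComponent r) P leg₂ leg₂)
    (p₃ : MovesAlong (firstComponent r) P leg₂ leg₃)
    (q₁ : MovesAlong (firstComponent r) Q leg₃ leg₁)
    (q₂ : MovesAlong (firstComponent r) Q leg₃ leg₂)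
    (q₃ : MovesAlong (firstComponent r) Q leg₃ leg₃) (F : (A ⊗[ℂ] A) ⊗[ℂ] A) :
    P (Q F) = Q (P F) := by
  have d12 := isDerivationAlong_op12 r
  have d13 : IsDerivationAlong (AlgHom.id ℂ _) (op13 r.toLinearMap) :=
    isDerivationAlong_conjEnd _ d12
  have d23 : IsDerivationAlong (AlgHom.id ℂ _) (op23 r.toLinearMap) :=
    isDerivationAlong_conjEnd _ d12
  have dP := Derivation.isDerivationAlong_id P
  have dQ := Derivation.isDerivationAlong_id Q
  -- Q(u) depends only on u and w, and there P agrees with -r₁₂ + r₂₃: r₁₂ kills w, r₂₃ kills u, and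
  -- unitarity gives r₂₃ the value -φ_v on w.
  have hP (F : A ⊗[ℂ] A) : P (productMap leg₁ leg₃ F)
      = -op12 r.toLinearMap (productMap leg₁ leg₃ F)
        + op23 r.toLinearMap (productMap leg₁ leg₃ F) := by
    refine derivation_eq_on_productMap dP (d12.neg.add d23) (fun a => ?_) (fun a => ?_) F
    · simp [op12_leg₁, op23_leg₁, p₁ a]
    · simp [op12_leg₃, op23_leg₃ hr, p₃ a]
  have hQ (F : A ⊗[ℂ] A) : Q (productMap leg₁ leg₂ F)
      = -op13 r.toLinearMap (productMap leg₁ leg₂ F)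
        + -op23 r.toLinearMap (productMap leg₁ leg₂ F) := by
    refine derivation_eq_on_productMap dQ (d13.neg.add d23.neg) (fun a => ?_) (fun a => ?_) F
    · simp [op13_leg₁, op23_leg₁, q₁ a]
    · simp [op13_leg₂, op23_leg₂, q₂ a]
  -- As r₂₃ kills u, substituting the two formulas turns PQ - QP on u into exactly the left side of
  -- the classical Yang–Baxter equation.
  have h₁ (a : A) : P (Q (leg₁ a)) = Q (P (leg₁ a)) := by
    have h := LinearMap.congr_fun hr.cybe (leg₁ a)
    simp only [Ring.lie_def, LinearMap.add_apply, LinearMap.sub_apply, Module.End.mul_apply,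
      op12_leg₁, op13_leg₁, op23_leg₁, map_zero, LinearMap.zero_apply] at h
    rw [q₁ a, p₁ a, map_neg, map_neg, hP, hQ]
    linear_combination h
  have onLeg {x : A →ₐ[ℂ] (A ⊗[ℂ] A) ⊗[ℂ] A} (px : MovesAlong (firstComponent r) P leg₂ x)
      (qx : MovesAlong (firstComponent r) Q leg₃ x) (a : A) :
      P (Q (x a)) = Q (P (x a)) := by
    -- Substituting x for u is compatible with P and Q, because they move every coordinate by the
    -- same rule. The relation found on the first leg thus passes to the others by restriction to
    -- the diagonals u = v and u = w.
    let s : (A ⊗[ℂ] A) ⊗[ℂ] A →ₐ[ℂ] (A ⊗[ℂ] A) ⊗[ℂ] A := productMap (productMap x leg₂) leg₃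
    have s₁ : s.comp leg₁ = x := by ext; simp [s, leg₁_apply]
    have s₂ : s.comp leg₂ = leg₂ := by ext; simp [s, leg₂_apply]
    have s₃ : s.comp leg₃ = leg₃ := by ext; simp [s, leg₃_apply, ← one_def]
    have sP := intertwines_three p₁ p₂ p₃ (Q' := P) s (by rwa [s₁, s₂]) (by rwa [s₂])
      (by rwa [s₂, s₃])
    have sQ := intertwines_three q₁ q₂ q₃ (Q' := Q) s (by rwa [s₁, s₃]) (by rwa [s₂, s₃])
      (by rwa [s₃])
    have := congrArg s (h₁ a)
    rw [sP, sQ, sQ, sP] at this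
    rwa [← AlgHom.comp_apply, s₁] at this
  have hc : ⁅P, Q⁆ = 0 := Derivation.ext fun G => LinearMap.congr_fun
    (IsDerivationAlong.legs_ext (f := AlgHom.id ℂ _) (d := ⁅P, Q⁆.toLinearMap) (d' := 0)
      (Derivation.isDerivationAlong_id ⁅P, Q⁆) (fun _ _ => by simp)
      (fun a => sub_eq_zero.mpr (onLeg p₁ q₁ a)) (fun a => sub_eq_zero.mpr (onLeg p₂ q₂ a))
      fun a => sub_eq_zero.mpr (onLeg p₃ q₃ a)) G
  exact sub_eq_zero.mp (Derivation.congr_fun hc F)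

end ClassicalYangBaxter

open Algebra.TensorProduct

/-! ### Formal points and the action of formal maps on them -/

section Points

variable {A C C' : Type*} [CommRing A] [Algebra ℂ A] [CommRing C] [Algebra ℂ C]
  [CommRing C'] [Algebra ℂ C']

/-- The action of a formal map `h(x, y)` on a pair of formal points. -/
def pointMap (h : A →ₐ[ℂ] (A ⊗[ℂ] A)⟦X⟧) (x y : A →ₐ[ℂ] C⟦X⟧) : A →ₐ[ℂ] C⟦X⟧ :=
  (extendHom (productMap x y)).comp h

/-- The action of a formal diffeomorphism of `X × X` on a formal point of `X × X`. -/
def actPair (R : A ⊗[ℂ] A →ₐ[ℂ] (A ⊗[ℂ] A)⟦X⟧) (p : A ⊗[ℂ] A →ₐ[ℂ] C⟦X⟧) :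
    A ⊗[ℂ] A →ₐ[ℂ] C⟦X⟧ :=
  (extendHom p).comp R

lemma algHom_tensor_ext {B : Type*} [CommRing B] [Algebra ℂ B] {f g : A ⊗[ℂ] B →ₐ[ℂ] C}
    (hl : f.comp includeLeft = g.comp includeLeft)
    (hr : f.comp includeRight = g.comp includeRight) : f = g :=
  Algebra.TensorProduct.ext hl hr

/-- Naturality of h in its points: reparametrizing (here, flowing) the output amounts to
reparametrizing both arguments. -/
lemma extendHom_comp_pointMap (h : A →ₐ[ℂ] (A ⊗[ℂ] A)⟦X⟧) (p : C →ₐ[ℂ] C'⟦X⟧)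
    (x y : A →ₐ[ℂ] C⟦X⟧) : (extendHom p).comp (pointMap h x y)
      = pointMap h ((extendHom p).comp x) ((extendHom p).comp y) := by
  rw [pointMap, pointMap, ← AlgHom.comp_assoc, extendHom_comp_extendHom, comp_productMap]

lemma extendHom_comp_const (p : C →ₐ[ℂ] C'⟦X⟧) (x : A →ₐ[ℂ] C) :
    (extendHom p).comp (oneFormal.comp x) = p.comp x := by
  rw [← AlgHom.comp_assoc, extendHom_comp_oneFormal]

lemma productMap_const (x y : A →ₐ[ℂ] C) :
    productMap (oneFormal.comp x) (oneFormal.comp y) = oneFormal.comp (productMap x y) := by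
  refine algHom_tensor_ext ?_ ?_
  · rw [AlgHom.comp_assoc, productMap_left, productMap_left]
  · rw [AlgHom.comp_assoc, productMap_right, productMap_right]

lemma pointMap_const (h : A →ₐ[ℂ] (A ⊗[ℂ] A)⟦X⟧) (x y : A →ₐ[ℂ] C) :
    pointMap h (oneFormal.comp x) (oneFormal.comp y)
      = (PowerSeries.mapAlgHom (productMap x y)).comp h := by
  rw [pointMap, productMap_const, mapAlgHom_eq_extendHom]

lemma coeff_zero_pointMap {h : A →ₐ[ℂ] (A ⊗[ℂ] A)⟦X⟧}
    (h0 : ∀ a, PowerSeries.coeff 0 (h a) = a ⊗ₜ 1) (x y : A →ₐ[ℂ] C⟦X⟧) (a : A) :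
    PowerSeries.coeff 0 (pointMap h x y a) = PowerSeries.coeff 0 (x a) := by
  rw [pointMap, AlgHom.comp_apply, coeff_zero_extendHom, h0, productMap_left_apply]

lemma extendHom_comp_formal12 (R : A ⊗[ℂ] A →ₐ[ℂ] (A ⊗[ℂ] A)⟦X⟧) (x y z : A →ₐ[ℂ] C⟦X⟧) :
    (extendHom (productMap (productMap x y) z)).comp (formal12 R)
      = productMap (actPair R (productMap x y)) z := by
  refine algHom_tensor_ext ?_ ?_
  · rw [productMap_left, AlgHom.comp_assoc, formal12, productMap_left, ← AlgHom.comp_assoc,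
      extendHom_comp_mapAlgHom, productMap_left, actPair]
  · rw [productMap_right, AlgHom.comp_assoc, formal12, productMap_right, extendHom_comp_const,
      productMap_right]

lemma extendHom_comp_conjFormal {B : Type*} [CommRing B] [Algebra ℂ B] (e : B ≃ₐ[ℂ] B)
    (g : B →ₐ[ℂ] B⟦X⟧) (p : B →ₐ[ℂ] C⟦X⟧) :
    (extendHom p).comp (conjFormal e g)
      = ((extendHom (p.comp e.symm.toAlgHom)).comp g).comp e.toAlgHom := by
  rw [conjFormal, ← AlgHom.comp_assoc, extendHom_comp_mapAlgHom, AlgHom.comp_assoc]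

lemma productMap_comp_swap23 (x y z : A →ₐ[ℂ] C) :
    (productMap (productMap x y) z).comp (swap23 A).toAlgHom
      = productMap (productMap x z) y := by
  refine AlgHom.ext fun F => LinearMap.congr_fun (TensorProduct.ext_threefold
    (g := ((productMap (productMap x y) z).comp (swap23 A).toAlgHom).toLinearMap)
    (h := (productMap (productMap x z) y).toLinearMap) fun a b c => ?_) F
  change x a * y c * z b = x a * z b * y c
  ring

lemma productMap_comp_swap23_symm (x y z : A →ₐ[ℂ] C) :
    (productMap (productMap x y) z).comp (swap23 A).symm.toAlgHom
      = productMap (productMap x z) y := by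
  refine AlgHom.ext fun F => LinearMap.congr_fun (TensorProduct.ext_threefold
    (g := ((productMap (productMap x y) z).comp (swap23 A).symm.toAlgHom).toLinearMap)
    (h := (productMap (productMap x z) y).toLinearMap) fun a b c => ?_) F
  change x a * y c * z b = x a * z b * y c
  ring

lemma productMap_comp_cyc (x y z : A →ₐ[ℂ] C) :
    (productMap (productMap x y) z).comp (cyc A).toAlgHom
      = productMap (productMap z x) y := by
  refine AlgHom.ext fun F => LinearMap.congr_fun (TensorProduct.ext_threefold
    (g := ((productMap (productMap x y) z).comp (cyc A).toAlgHom).toLinearMap)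
    (h := (productMap (productMap z x) y).toLinearMap) fun a b c => ?_) F
  change x b * y c * z a = z a * x b * y c
  ring

lemma productMap_comp_cyc_symm (x y z : A →ₐ[ℂ] C) :
    (productMap (productMap x y) z).comp (cyc A).symm.toAlgHom
      = productMap (productMap y z) x := by
  refine AlgHom.ext fun F => LinearMap.congr_fun (TensorProduct.ext_threefold
    (g := ((productMap (productMap x y) z).comp (cyc A).symm.toAlgHom).toLinearMap)
    (h := (productMap (productMap y z) x).toLinearMap) fun a b c => ?_) F
  change x c * y a * z b = y a * z b * x c
  ring

lemma extendHom_comp_formal12' {R : A ⊗[ℂ] A →ₐ[ℂ] (A ⊗[ℂ] A)⟦X⟧} {x y x' y' : A →ₐ[ℂ] C⟦X⟧}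
    (h : actPair R (productMap x y) = productMap x' y') (z : A →ₐ[ℂ] C⟦X⟧) :
    (extendHom (productMap (productMap x y) z)).comp (formal12 R)
      = productMap (productMap x' y') z := by
  rw [extendHom_comp_formal12, h]

lemma extendHom_comp_formal13 {R : A ⊗[ℂ] A →ₐ[ℂ] (A ⊗[ℂ] A)⟦X⟧} {x z x' z' : A →ₐ[ℂ] C⟦X⟧}
    (h : actPair R (productMap x z) = productMap x' z') (y : A →ₐ[ℂ] C⟦X⟧) :
    (extendHom (productMap (productMap x y) z)).comp (formal13 R)
      = productMap (productMap x' y) z' := by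
  rw [formal13, extendHom_comp_conjFormal, productMap_comp_swap23_symm,
    extendHom_comp_formal12' h, productMap_comp_swap23]

lemma extendHom_comp_formal23 {R : A ⊗[ℂ] A →ₐ[ℂ] (A ⊗[ℂ] A)⟦X⟧} {y z y' z' : A →ₐ[ℂ] C⟦X⟧}
    (h : actPair R (productMap y z) = productMap y' z') (x : A →ₐ[ℂ] C⟦X⟧) :
    (extendHom (productMap (productMap x y) z)).comp (formal23 R)
      = productMap (productMap x y') z' := by
  rw [formal23, extendHom_comp_conjFormal, productMap_comp_cyc_symm,
    extendHom_comp_formal12' h, productMap_comp_cyc]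

end Points

/-! ### From a cycle map to a quantum R-matrix -/

section CycleMap

variable {A C : Type*} [CommRing A] [Algebra ℂ A] [CommRing C] [Algebra ℂ C]

/-- A family of formal maps `h(x, y)`, trivial modulo `ħ`, with
`h(h(x, z), h(y, z)) = h(h(x, y), h(z, y))`. -/
structure IsCycleMap (h : A →ₐ[ℂ] (A ⊗[ℂ] A)⟦X⟧) : Prop where
  coeff_zero : ∀ a, PowerSeries.coeff 0 (h a) = a ⊗ₜ 1
  cycle : pointMap h (pointMap h (oneFormal.comp leg₁) (oneFormal.comp leg₃))
      (pointMap h (oneFormal.comp leg₂) (oneFormal.comp leg₃))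
    = pointMap h (pointMap h (oneFormal.comp leg₁) (oneFormal.comp leg₂))
      (pointMap h (oneFormal.comp leg₃) (oneFormal.comp leg₂))

/-- The defining identity concerns the universal triple of points; substitution gives it for every
triple. -/
lemma IsCycleMap.cycle_points {h : A →ₐ[ℂ] (A ⊗[ℂ] A)⟦X⟧} (hh : IsCycleMap h)
    (x y z : A →ₐ[ℂ] C⟦X⟧) :
    pointMap h (pointMap h x z) (pointMap h y z) = pointMap h (pointMap h x y) (pointMap h z y) := by
  have key := congrArg (fun f => (extendHom (productMap (productMap x y) z)).comp f) hh.cycle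
  have e₁ : (productMap (productMap x y) z).comp leg₁ = x := by
    rw [leg₁, ← AlgHom.comp_assoc, productMap_left, productMap_left]
  have e₂ : (productMap (productMap x y) z).comp leg₂ = y := by
    rw [leg₂, ← AlgHom.comp_assoc, productMap_left, productMap_right]
  have e₃ : (productMap (productMap x y) z).comp leg₃ = z := productMap_right _ _
  simpa only [extendHom_comp_pointMap, extendHom_comp_const, e₁, e₂, e₃] using key

/-- The formal diffeomorphism `(x, y) ↦ (h(x, y), y)`. -/
def twist (h : A →ₐ[ℂ] (A ⊗[ℂ] A)⟦X⟧) : A ⊗[ℂ] A →ₐ[ℂ] (A ⊗[ℂ] A)⟦X⟧ :=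
  productMap h (oneFormal.comp includeRight)

lemma twist_tmul (h : A →ₐ[ℂ] (A ⊗[ℂ] A)⟦X⟧) (a b : A) :
    twist h (a ⊗ₜ b) = h a * PowerSeries.C (1 ⊗ₜ b) := rfl

lemma isFormalDiffeo_twist {h : A →ₐ[ℂ] (A ⊗[ℂ] A)⟦X⟧}
    (h0 : ∀ a, PowerSeries.coeff 0 (h a) = a ⊗ₜ 1) : IsFormalDiffeo (twist h) := by
  intro F
  induction F with
  | zero => simp
  | add F G hF hG => rw [map_add, map_add, hF, hG]
  | tmul a b => simp [twist_tmul, PowerSeries.coeff_mul_C, h0]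

lemma actPair_twist (h : A →ₐ[ℂ] (A ⊗[ℂ] A)⟦X⟧) (x y : A →ₐ[ℂ] C⟦X⟧) :
    actPair (twist h) (productMap x y) = productMap (pointMap h x y) y := by
  rw [actPair, twist, comp_productMap, extendHom_comp_const, productMap_right, pointMap]

lemma actPair_actPair (R S : A ⊗[ℂ] A →ₐ[ℂ] (A ⊗[ℂ] A)⟦X⟧) (p : A ⊗[ℂ] A →ₐ[ℂ] C⟦X⟧) :
    actPair R (actPair S p) = actPair ((extendHom S).comp R) p := by
  rw [actPair, actPair, actPair, ← AlgHom.comp_assoc, extendHom_comp_extendHom]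

lemma actPair_formal21 (R : A ⊗[ℂ] A →ₐ[ℂ] (A ⊗[ℂ] A)⟦X⟧) (x y : A →ₐ[ℂ] C⟦X⟧) :
    actPair (formal21 R) (productMap x y)
      = (actPair R (productMap y x)).comp (flip A).toAlgHom := by
  have e : (productMap x y).comp (flip A).symm.toAlgHom = productMap y x :=
    productMap_comp_flip x y
  rw [actPair, formal21, extendHom_comp_conjFormal, e, actPair]

lemma isFormalDiffeo_formal21 {R : A ⊗[ℂ] A →ₐ[ℂ] (A ⊗[ℂ] A)⟦X⟧} (hR : IsFormalDiffeo R) :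
    IsFormalDiffeo (formal21 R) := fun F => by
  change PowerSeries.coeff 0
    (PowerSeries.mapAlgHom (flip A).symm.toAlgHom (R (flip A F))) = F
  rw [coeff_mapAlgHom, hR]
  exact (flip A).symm_apply_apply F

/-- `R` is the quotient of the opposite twist by the twist. -/
lemma actPair_quotient {h : A →ₐ[ℂ] (A ⊗[ℂ] A)⟦X⟧} {R : A ⊗[ℂ] A →ₐ[ℂ] (A ⊗[ℂ] A)⟦X⟧}
    (hR : (extendHom (twist h)).comp R = formal21 (twist h)) (x y : A →ₐ[ℂ] C⟦X⟧) :
    actPair R (productMap (pointMap h x y) y) = productMap x (pointMap h y x) := by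
  rw [← actPair_twist, actPair_actPair, hR, actPair_formal21, actPair_twist, productMap_comp_flip]

lemma productMap_includes_const :
    productMap (oneFormal.comp (includeLeft : A →ₐ[ℂ] A ⊗[ℂ] A)) (oneFormal.comp includeRight)
      = oneFormal := by
  rw [productMap_const]; ext <;> simp

/-- R sends (h(x, y), y) to (x, h(y, x)), and R₂₁, which is R with the roles of x and y exchanged,
sends it back. Testing on points in the image of T suffices because T is injective. -/
lemma quotient_unitarity {h : A →ₐ[ℂ] (A ⊗[ℂ] A)⟦X⟧}
    (h0 : ∀ a, PowerSeries.coeff 0 (h a) = a ⊗ₜ 1) {R : A ⊗[ℂ] A →ₐ[ℂ] (A ⊗[ℂ] A)⟦X⟧}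
    (hR : (extendHom (twist h)).comp R = formal21 (twist h)) :
    mulFormal R (formal21 R) = oneFormal := by
  refine AlgHom.ext fun F => extendHom_injective (isFormalDiffeo_twist h0) ?_
  refine AlgHom.congr_fun (φ₁ := (extendHom (twist h)).comp (mulFormal R (formal21 R)))
    (φ₂ := (extendHom (twist h)).comp oneFormal) ?_ F
  rw [extendHom_comp_oneFormal, mulFormal, hExt_eq_extendHom, ← AlgHom.comp_assoc,
    extendHom_comp_extendHom, hR]
  change actPair (formal21 R) (formal21 (twist h)) = twist h
  set x : A →ₐ[ℂ] (A ⊗[ℂ] A)⟦X⟧ := oneFormal.comp includeLeft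
  set y : A →ₐ[ℂ] (A ⊗[ℂ] A)⟦X⟧ := oneFormal.comp includeRight
  -- (x, y) is the tautological point, so acting on it recovers S.
  have e (S : A ⊗[ℂ] A →ₐ[ℂ] (A ⊗[ℂ] A)⟦X⟧) : actPair S (productMap x y) = S := by
    rw [productMap_includes_const, actPair]
    refine AlgHom.ext fun F => ?_
    ext n
    rw [← AlgHom.comp_id oneFormal, ← mapAlgHom_eq_extendHom]
    simp [coeff_mapAlgHom]
  have e₁ : twist h = productMap (pointMap h x y) y := by
    rw [← actPair_twist, e]
  have e₂ : formal21 (twist h) = productMap x (pointMap h y x) := by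
    rw [← e (formal21 (twist h)), actPair_formal21, actPair_twist, productMap_comp_flip]
  rw [e₂, actPair_formal21, actPair_quotient hR, productMap_comp_flip, e₁]

lemma IsCycleMap.quotient_qybe {h : A →ₐ[ℂ] (A ⊗[ℂ] A)⟦X⟧} (hh : IsCycleMap h)
    {R : A ⊗[ℂ] A →ₐ[ℂ] (A ⊗[ℂ] A)⟦X⟧}
    (hR : (extendHom (twist h)).comp R = formal21 (twist h)) :
    mulFormal (mulFormal (formal12 R) (formal13 R)) (formal23 R)
      = mulFormal (mulFormal (formal23 R) (formal13 R)) (formal12 R) := by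
  set u : A →ₐ[ℂ] ((A ⊗[ℂ] A) ⊗[ℂ] A)⟦X⟧ := oneFormal.comp leg₁ with hu
  set v : A →ₐ[ℂ] ((A ⊗[ℂ] A) ⊗[ℂ] A)⟦X⟧ := oneFormal.comp leg₂ with hv
  set w : A →ₐ[ℂ] ((A ⊗[ℂ] A) ⊗[ℂ] A)⟦X⟧ := oneFormal.comp leg₃ with hw
  -- This point is chosen so that at every step the pair acted upon has the form (h(x, y), y),
  -- possibly after the cycle identity. It is trivial modulo ħ, so it can be cancelled.
  let t : (A ⊗[ℂ] A) ⊗[ℂ] A →ₐ[ℂ] ((A ⊗[ℂ] A) ⊗[ℂ] A)⟦X⟧ :=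
    productMap (productMap (pointMap h (pointMap h u w) (pointMap h v w)) (pointMap h v w)) w
  have ht : IsFormalDiffeo t := by
    intro F
    induction F with
    | zero => simp
    | add F G hF hG => rw [map_add, map_add, hF, hG]
    | tmul F c =>
      induction F with
      | zero => simp
      | add F G hF hG => rw [TensorProduct.add_tmul, map_add, map_add, hF, hG]
      | tmul a b =>
        simp only [t, productMap_apply_tmul, PowerSeries.coeff_zero_eq_constantCoeff_apply, map_mul]
        simp only [← PowerSeries.coeff_zero_eq_constantCoeff_apply,
          coeff_zero_pointMap hh.coeff_zero, tmul_eq_legs]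
        simp [hu, hv, hw, oneFormal_apply]
  have expand (f g k : (A ⊗[ℂ] A) ⊗[ℂ] A →ₐ[ℂ] ((A ⊗[ℂ] A) ⊗[ℂ] A)⟦X⟧) :
      (extendHom t).comp (mulFormal (mulFormal f g) k)
        = (extendHom ((extendHom ((extendHom t).comp f)).comp g)).comp k := by
    simp only [mulFormal, hExt_eq_extendHom, ← AlgHom.comp_assoc, extendHom_comp_extendHom]
  refine AlgHom.ext fun F => extendHom_injective ht (AlgHom.congr_fun
    (φ₁ := (extendHom t).comp (mulFormal (mulFormal (formal12 R) (formal13 R)) (formal23 R)))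
    (φ₂ := (extendHom t).comp (mulFormal (mulFormal (formal23 R) (formal13 R)) (formal12 R)))
    ?_ F)
  have q (x y : A →ₐ[ℂ] ((A ⊗[ℂ] A) ⊗[ℂ] A)⟦X⟧) := actPair_quotient hR x y
  -- Both sides send t to (u, h(v, u), h(h(w, u), h(v, u))). The instance (v, u, w) prepares R₂₃ on
  -- the left, (u, v, w) prepares R₁₃ on the right, and (w, v, u) identifies the two third
  -- coordinates.
  rw [expand, expand, extendHom_comp_formal12' (q _ _), extendHom_comp_formal13 (q _ _),
    hh.cycle_points v u w, extendHom_comp_formal23 (q _ _), extendHom_comp_formal23 (q _ _),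
    hh.cycle_points u v w, extendHom_comp_formal13 (q _ _), extendHom_comp_formal12' (q _ _),
    hh.cycle_points w v u]

end CycleMap

/-! ### Quantization of a classical r-matrix -/

section Quantization

variable {A : Type*} [CommRing A] [Algebra ℂ A]

/-- The time-`ħ` flow of the vector field `(x, y) ↦ (-φ_y(x), -φ_y(y))`, in the first factor, is a
cycle map. -/
lemma IsClassicalRMatrix.exists_isCycleMap {r : Derivation ℂ (A ⊗[ℂ] A) (A ⊗[ℂ] A)}
    (hr : IsClassicalRMatrix r) :
    ∃ h : A →ₐ[ℂ] (A ⊗[ℂ] A)⟦X⟧, IsCycleMap h ∧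
      ∀ a, PowerSeries.coeff 1 (h a) = -r (a ⊗ₜ 1) := by
  have hD := isDerivationAlong_firstComponent r
  obtain ⟨Q, hl, hrr⟩ := exists_movesAlong_two hD
  obtain ⟨V, v₁, v₂, v₃⟩ := exists_movesAlong_three hD leg₂
  obtain ⟨W, w₁, w₂, w₃⟩ := exists_movesAlong_three hD leg₃
  refine ⟨(expHom Q).comp includeLeft, ⟨fun a => coeff_zero_expHom _ _, ?_⟩, fun a => ?_⟩
  · set h := (expHom Q).comp (includeLeft : A →ₐ[ℂ] A ⊗[ℂ] A)
    -- By naturality, the flow of any P that moves x and y along -φ_y moves x to h(x, y), whatever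
    -- it does to other coordinates.
    have key {P : Derivation ℂ ((A ⊗[ℂ] A) ⊗[ℂ] A) ((A ⊗[ℂ] A) ⊗[ℂ] A)}
        {x y : A →ₐ[ℂ] (A ⊗[ℂ] A) ⊗[ℂ] A} (hx : MovesAlong (firstComponent r) P y x)
        (hy : MovesAlong (firstComponent r) P y y) :
        pointMap h (oneFormal.comp x) (oneFormal.comp y) = (expHom P).comp x := by
      rw [pointMap_const, ← AlgHom.comp_assoc,
        ← expHom_comp_of_intertwines (intertwines_two hl hrr hx hy), AlgHom.comp_assoc,
        productMap_left]
    have hc := extendHom_expHom_comm (hr.commute v₁ v₂ v₃ w₁ w₂ w₃)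
    -- Only the first coordinate is needed. Flowing h(u, w) along V gives h(h(u, v), h(w, v)), and
    -- flowing h(u, v) along W gives h(h(u, w), h(v, w)).
    have hVW := congrArg (fun f => f.comp leg₁) hc
    simp only [AlgHom.comp_assoc, ← key v₁ v₂, ← key w₁ w₃] at hVW
    simp only [extendHom_comp_pointMap, extendHom_comp_const, ← key v₁ v₂, ← key v₃ v₂,
      ← key w₁ w₃, ← key w₂ w₃] at hVW
    exact hVW.symm
  · rw [AlgHom.comp_apply, coeff_one_expHom, hl a]
    congr 1
    have e : productMap includeLeft includeRight = AlgHom.id ℂ (A ⊗[ℂ] A) := by ext <;> simp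
    rw [e]
    rfl

lemma quotient_formal {h : A →ₐ[ℂ] (A ⊗[ℂ] A)⟦X⟧}
    (h0 : ∀ a, PowerSeries.coeff 0 (h a) = a ⊗ₜ 1) {R : A ⊗[ℂ] A →ₐ[ℂ] (A ⊗[ℂ] A)⟦X⟧}
    (hR : (extendHom (twist h)).comp R = formal21 (twist h)) : IsFormalDiffeo R := fun F => by
  have e := congrArg (PowerSeries.coeff 0) (AlgHom.congr_fun hR F)
  rwa [AlgHom.comp_apply, coeff_zero_extendHom, isFormalDiffeo_twist h0,
    isFormalDiffeo_formal21 (isFormalDiffeo_twist h0)] at e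

/-- The ħ-term of R is that of T₂₁ minus that of T. The latter is minus the first component of `r`;
the former is its second component, by unitarity. -/
lemma IsClassicalRMatrix.coeff_one_quotient {r : Derivation ℂ (A ⊗[ℂ] A) (A ⊗[ℂ] A)}
    (hr : IsClassicalRMatrix r) {h : A →ₐ[ℂ] (A ⊗[ℂ] A)⟦X⟧}
    (h0 : ∀ a, PowerSeries.coeff 0 (h a) = a ⊗ₜ 1)
    (h1 : ∀ a, PowerSeries.coeff 1 (h a) = -r (a ⊗ₜ 1)) {R : A ⊗[ℂ] A →ₐ[ℂ] (A ⊗[ℂ] A)⟦X⟧}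
    (hR : (extendHom (twist h)).comp R = formal21 (twist h)) (F : A ⊗[ℂ] A) :
    PowerSeries.coeff 1 (R F) = r F := by
  have e := congrArg (PowerSeries.coeff 1) (AlgHom.congr_fun hR F)
  rw [AlgHom.comp_apply, coeff_one_extendHom, isFormalDiffeo_twist h0,
    quotient_formal h0 hR] at e
  rw [eq_sub_of_add_eq e]
  change PowerSeries.coeff 1 (PowerSeries.mapAlgHom (flip A).symm.toAlgHom
    (twist h (flip A F))) - _ = _
  rw [coeff_mapAlgHom]
  change flip A (PowerSeries.coeff 1 (twist h (flip A F))) - _ = _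
  clear e
  induction F with
  | zero => simp
  | add F G hF hG =>
    rw [map_add r, ← hF, ← hG]
    simp only [map_add]
    ring
  | tmul a b =>
    have er : r (a ⊗ₜ b) = (1 ⊗ₜ b) * r (a ⊗ₜ 1) + (a ⊗ₜ 1) * r (1 ⊗ₜ b) := by
      have : a ⊗ₜ[ℂ] b = (a ⊗ₜ 1) * (1 ⊗ₜ b) := by simp
      rw [this, Derivation.leibniz, smul_eq_mul, smul_eq_mul]; ring
    rw [er, hr.apply_right, flip_tmul, twist_tmul, twist_tmul, PowerSeries.coeff_mul_C,
      PowerSeries.coeff_mul_C, h1, h1, map_mul, map_neg, flip_tmul]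
    change -flip A (firstComponent r b) * _ - _ = _
    ring

end Quantization

end GeometricRMatrix

end

theorem theorem1 {A : Type*} [CommRing A] [Algebra ℂ A] [Algebra.Smooth ℂ A]
    (r : Derivation ℂ (A ⊗[ℂ] A) (A ⊗[ℂ] A)) (hr : GeometricRMatrix.IsClassicalRMatrix r) :
    ∃ R : A ⊗[ℂ] A →ₐ[ℂ] (A ⊗[ℂ] A)⟦X⟧, GeometricRMatrix.IsQuantization R r := by
  open GeometricRMatrix in
  obtain ⟨h, hh, h1⟩ := hr.exists_isCycleMap
  obtain ⟨R, hR⟩ := exists_comp_eq_of_formal (isFormalDiffeo_twist hh.coeff_zero)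
    (formal21 (twist h))
  exact ⟨R, { formal := quotient_formal hh.coeff_zero hR
              qybe := hh.quotient_qybe hR
              unitarity := quotient_unitarity hh.coeff_zero hR
              firstOrder := hr.coeff_one_quotient hh.coeff_zero h1 hR }⟩
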